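/- Let $\mathcal A,\mathcal B,\mathcal M,\mathcal R$ be finite-dimensional von Neumann algebras (that is, finite-dimensional unital $C^*$-algebras), equipped with faithful positive traces $\tau_{\mathcal A},\tau_{\mathcal B},\tau_{\mathcal M},\tau_{\mathcal R}$, not necessarily normalized. A density operator of $\mathcal M$ is an element $\rho\ge 0$ with $\tau_{\mathcal M}(\rho)=1$; write $D(\mathcal M)$ for the set of density operators and $H(\rho)=-\tau_{\mathcal M}(\rho\log\rho)$ for the entropy (with $0\log 0=0$), and similarly for the other algebras, each with its own trace. A quantum channel is a completely positive trace preserving linear map. The adjoint $\Phi^\dagger:\mathcal Y\to\mathcal X$ of a $*$-preserving linear map $\Phi:\mathcal X\to\mathcal Y$ is the linear map determined by $\tau_{\mathcal X}(\Phi^\dagger(y)x)=\tau_{\mathcal Y}(y\,\Phi(x))$ for all $x\in\mathcal X$, $y\in\mathcal Y$. Suppose that $\mathcal R\subset\mathcal A$ is a unital $*$-subalgebra (the trace $\tau_{\mathcal R}$ need not be the restriction of $\tau_{\mathcal A}$), and let $E_{\mathcal R}:\mathcal A\to\mathcal R$ be the adjoint of the inclusion. Let $\Phi_A:\mathcal M\to\mathcal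 A$ and $\Phi_B:\mathcal M\to\mathcal B$ be quantum channels. Then for every density operator $\rho\in D(\mathcal M)$, \[ H(\Phi_A(\rho))+H(\Phi_B(\rho))\;\ge\; H(\rho)+H(E_{\mathcal R}\circ\Phi_A(\rho))+\log\frac1c , \] where \[ c=\sup\{\tau_{\mathcal M}(\Phi_A^\dagger(a)\,\Phi_B^\dagger(b)) \;:\; a\in\mathcal A,\ a\ge 0,\ E_{\mathcal R}(a)=1,\ b\in D(\mathcal B)\}, \] the supremum of a nonempty bounded set of real numbers, which satisfies $0<c<\infty$. -/

import Mathlib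

/-!
A finite-dimensional von Neumann algebra is a unital C⋆-algebra that is finite-dimensional
over `ℂ` (equivalently, a ⋆-subalgebra of a matrix algebra).  The order is the C⋆-order.
-/

noncomputable section

namespace ChannelSSA

open scoped ComplexOrder

universe u v

/-- A faithful (positive, not necessarily normalized) trace on a C⋆-algebra. -/
structure FaithfulTrace (M : Type u) [CStarAlgebra M] [PartialOrder M] [StarOrderedRing M]
    extends M →ₗ[ℂ] ℂ where
  mul_comm' : ∀ x y : M, toFun (x * y) = toFun (y * x)
  nonneg' : ∀ x : M, 0 ≤ x → 0 ≤ toFun x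
  faithful' : ∀ x : M, 0 ≤ x → toFun x = 0 → x = 0

section

variable {M : Type u} [CStarAlgebra M] [PartialOrder M] [StarOrderedRing M]
variable {N : Type v} [CStarAlgebra N] [PartialOrder N] [StarOrderedRing N]

instance : CoeFun (FaithfulTrace M) (fun _ => M → ℂ) := ⟨fun τ => τ.toLinearMap⟩

/-- Density operators: positive elements of trace one. -/
def IsDensity (τ : FaithfulTrace M) (ρ : M) : Prop := 0 ≤ ρ ∧ τ ρ = 1

/-- The von Neumann entropy `H(ρ) = -τ(ρ log ρ)`, where `ρ log ρ` is the functional calculus of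
`t ↦ t log t` (with `0 log 0 = 0`). The trace of this self-adjoint element is real. -/
def entropy (τ : FaithfulTrace M) (ρ : M) : ℝ :=
  -(τ (cfc (fun t : ℝ => t * Real.log t) ρ)).re

/-- The map `x ↦ (y ↦ τ(x y))` from the algebra to its dual. -/
def FaithfulTrace.toDual (τ : FaithfulTrace M) : M →ₗ[ℂ] Module.Dual ℂ M :=
  (LinearMap.mul ℂ M).compr₂ τ.toLinearMap

theorem FaithfulTrace.toDual_apply (τ : FaithfulTrace M) (x y : M) :
    τ.toDual x y = τ (x * y) := rfl

theorem FaithfulTrace.toDual_injective (τ : FaithfulTrace M) :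
    Function.Injective τ.toDual := by
  rw [injective_iff_map_eq_zero]
  intro x hx
  have h : τ (x * star x) = 0 := by rw [← τ.toDual_apply, hx]; rfl
  exact CStarRing.mul_star_self_eq_zero_iff x |>.1 (τ.faithful' _ (mul_star_self_nonneg x) h)

/-- In finite dimensions the trace pairing identifies the algebra with its dual. -/
def FaithfulTrace.dualEquiv [FiniteDimensional ℂ M] (τ : FaithfulTrace M) :
    M ≃ₗ[ℂ] Module.Dual ℂ M :=
  LinearEquiv.ofInjectiveOfFinrankEq τ.toDual τ.toDual_injective
    Subspace.dual_finrank_eq.symm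

/-- The adjoint `Φ† : N → M` of a linear map `Φ : M → N` with respect to the traces, that is, the
unique linear map with `τ_M(Φ†(y) x) = τ_N(y Φ(x))`. For ⋆-preserving `Φ` (in particular for
positive maps and ⋆-homomorphisms) it is the adjoint for the inner products `τ(x⋆ y)`. -/
def traceAdjoint [FiniteDimensional ℂ M] (τM : FaithfulTrace M) (τN : FaithfulTrace N)
    (Φ : M →ₗ[ℂ] N) : N →ₗ[ℂ] M :=
  τM.dualEquiv.symm.toLinearMap ∘ₗ Φ.dualMap ∘ₗ τN.toDual

theorem traceAdjoint_spec [FiniteDimensional ℂ M] (τM : FaithfulTrace M) (τN : FaithfulTrace N)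
    (Φ : M →ₗ[ℂ] N) (y : N) (x : M) :
    τM (traceAdjoint τM τN Φ y * x) = τN (y * Φ x) := by
  have h : τM.dualEquiv (traceAdjoint τM τN Φ y) = Φ.dualMap (τN.toDual y) := by
    simp [traceAdjoint]
  exact congrArg (fun f : Module.Dual ℂ M => f x) h

theorem traceAdjoint_unique [FiniteDimensional ℂ M] (τM : FaithfulTrace M) (τN : FaithfulTrace N)
    (Φ : M →ₗ[ℂ] N) (Ψ : N →ₗ[ℂ] M) (h : ∀ y x, τM (Ψ y * x) = τN (y * Φ x)) :
    Ψ = traceAdjoint τM τN Φ := by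
  ext y
  apply τM.toDual_injective
  ext x
  rw [τM.toDual_apply, τM.toDual_apply, h, traceAdjoint_spec]

/-- A quantum channel: a completely positive trace preserving linear map. -/
structure QuantumChannel (τM : FaithfulTrace M) (τN : FaithfulTrace N)
    extends CompletelyPositiveMap M N where
  trace_preserving' : ∀ x : M, τN (toFun x) = τM x

instance (τM : FaithfulTrace M) (τN : FaithfulTrace N) :
    CoeFun (QuantumChannel τM τN) (fun _ => M → N) := ⟨fun Φ => Φ.toLinearMap⟩

/-- The adjoint `Φ†` of a quantum channel with respect to the traces. -/
def QuantumChannel.adjoint [FiniteDimensional ℂ M] {τM : FaithfulTrace M} {τN : FaithfulTrace N}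
    (Φ : QuantumChannel τM τN) : N →ₗ[ℂ] M :=
  traceAdjoint τM τN Φ.toLinearMap

/-- The map `E_R : A → R`, the adjoint of the embedding `ι : R → A` of a subalgebra. The trace of
`R` need not be the restriction of the trace of `A`. -/
def embeddingAdjoint {R : Type u} [CStarAlgebra R] [PartialOrder R] [StarOrderedRing R]
    [FiniteDimensional ℂ R] {A : Type v} [CStarAlgebra A] [PartialOrder A] [StarOrderedRing A]
    (τR : FaithfulTrace R) (τA : FaithfulTrace A) (ι : R →⋆ₐ[ℂ] A) : A →ₗ[ℂ] R :=
  traceAdjoint τR τA (ι : R →ₐ[ℂ] A).toLinearMap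

end

/-- The set of all `τ_M(Φ_A†(a) Φ_B†(b))` with `a ≥ 0`, `E_R(a) = 1` and `b` a density operator.
These traces of products of two positive elements are real. -/
def overlapSet {A B M R : Type*}
    [CStarAlgebra A] [PartialOrder A] [StarOrderedRing A]
    [CStarAlgebra B] [PartialOrder B] [StarOrderedRing B]
    [CStarAlgebra M] [PartialOrder M] [StarOrderedRing M] [FiniteDimensional ℂ M]
    [CStarAlgebra R] [PartialOrder R] [StarOrderedRing R] [FiniteDimensional ℂ R]
    {τA : FaithfulTrace A} {τB : FaithfulTrace B} {τM : FaithfulTrace M} (τR : FaithfulTrace R)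
    (ι : R →⋆ₐ[ℂ] A) (ΦA : QuantumChannel τM τA) (ΦB : QuantumChannel τM τB) : Set ℝ :=
  {t | ∃ a : A, ∃ b : B, 0 ≤ a ∧ embeddingAdjoint τR τA ι a = 1 ∧ IsDensity τB b ∧
    t = (τM (ΦA.adjoint a * ΦB.adjoint b)).re}

/-- The constant `c`, the supremum of the overlaps. -/
def overlapConst {A B M R : Type*}
    [CStarAlgebra A] [PartialOrder A] [StarOrderedRing A]
    [CStarAlgebra B] [PartialOrder B] [StarOrderedRing B]
    [CStarAlgebra M] [PartialOrder M] [StarOrderedRing M] [FiniteDimensional ℂ M]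
    [CStarAlgebra R] [PartialOrder R] [StarOrderedRing R] [FiniteDimensional ℂ R]
    {τA : FaithfulTrace A} {τB : FaithfulTrace B} {τM : FaithfulTrace M} (τR : FaithfulTrace R)
    (ι : R →⋆ₐ[ℂ] A) (ΦA : QuantumChannel τM τA) (ΦB : QuantumChannel τM τB) : ℝ :=
  sSup (overlapSet τR ι ΦA ΦB)

end ChannelSSA

end

/-!
Write `σ = Φ_A(ρ)`, `ω = Φ_B(ρ)`, `η = E_R(σ)`, and let `F` be the entire function

  `F(z) = τ_M(ρ ρ⁻ᶻ Φ_B†(ωᶻ) Φ_A†(ι(η)⁻ᶻ σᶻ))`.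

Then `F(0) = 1`, and `Re F'(0)` is `H(ρ) + H(η) - H(σ) - H(ω)`, so it suffices to show
`Re F'(0) ≤ log c`. By the three lines theorem this follows from `|F| ≤ 1` on `Re z = 0` and
`|F| ≤ √c` on `Re z = 1/2`. On the first line all powers are unitary and `Φ_A†`, `Φ_B†` are
contractions. On the second, the Cauchy–Schwarz inequality for `τ_M` and the Kadison–Schwarz
inequality for `Φ_A†` and `Φ_B†` give `|F|² ≤ τ_M(Φ_A†(v v⋆) Φ_B†(ω))` with `v = ι(η)⁻ᶻ σᶻ`; since
`E_R(v v⋆) = 1`, the definition of `c` applies.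

Powers require invertible states. Each of `ρ`, `ω` and `η` is shifted by `ε`, while `σ` is shifted
by `ε • a` with an invertible `a ≥ 0` such that `E_R(a) = 1`: this keeps `E_R` of the shifted `σ`
equal to the shifted `η`. The inequality then holds up to an error linear in `ε`.
-/

noncomputable section

namespace ChannelSSA

open scoped ComplexOrder

namespace FaithfulTrace

variable {M : Type*} [CStarAlgebra M] [PartialOrder M] [StarOrderedRing M] (τ : FaithfulTrace M)

/-- The trace as a bundled positive linear functional, which gives access to its continuity and to
the GNS inner product `⟪x, y⟫ = τ(x⋆ y)`. -/
def toPositiveLinearMap : M →ₚ[ℂ] ℂ :=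
  PositiveLinearMap.mk₀ τ.toLinearMap τ.nonneg'

protected theorem continuous : Continuous τ :=
  map_continuous τ.toPositiveLinearMap

theorem map_mul_comm (x y : M) : τ (x * y) = τ (y * x) :=
  τ.mul_comm' x y

protected theorem map_star (x : M) : τ (star x) = star (τ x) :=
  StarHomClass.map_star τ.toPositiveLinearMap x

theorem ext_mul_right {x y : M} (h : ∀ m, τ (x * m) = τ (y * m)) : x = y :=
  τ.toDual_injective (LinearMap.ext h)

protected theorem map_nonneg {x : M} (hx : 0 ≤ x) : 0 ≤ τ x :=
  τ.nonneg' x hx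

theorem re_map_nonneg {x : M} (hx : 0 ≤ x) : 0 ≤ (τ x).re :=
  (Complex.nonneg_iff.1 (τ.map_nonneg hx)).1

theorem re_map_mono {x y : M} (h : x ≤ y) : (τ x).re ≤ (τ y).re :=
  (Complex.le_def.1 (OrderHomClass.mono τ.toPositiveLinearMap h)).1

theorem ofReal_re_map {x : M} (hx : 0 ≤ x) : ((τ x).re : ℂ) = τ x :=
  Complex.ext rfl (Complex.nonneg_iff.1 (τ.map_nonneg hx)).2

theorem re_map_pos {x : M} (hx : 0 ≤ x) (hx0 : x ≠ 0) : 0 < (τ x).re :=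
  (τ.re_map_nonneg hx).lt_of_ne' fun h =>
    hx0 (τ.faithful' x hx ((τ.ofReal_re_map hx).symm.trans (by rw [h, Complex.ofReal_zero])))

theorem re_map_real_smul (r : ℝ) (x : M) : (τ (r • x)).re = r * (τ x).re := by
  rw [← Complex.coe_smul, map_smul, smul_eq_mul, Complex.re_ofReal_mul]

theorem re_map_algebraMap (r : ℝ) : (τ (algebraMap ℝ M r)).re = r * (τ 1).re := by
  rw [Algebra.algebraMap_eq_smul_one, re_map_real_smul]

theorem map_mul_nonneg {x y : M} (hx : 0 ≤ x) (hy : 0 ≤ y) : 0 ≤ τ (x * y) := by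
  obtain ⟨s, rfl⟩ := CStarAlgebra.nonneg_iff_eq_star_mul_self.1 hx
  rw [mul_assoc, τ.map_mul_comm]
  exact τ.map_nonneg (star_right_conjugate_nonneg hy s)

theorem re_map_mul_mono {x x' y y' : M} (hx : 0 ≤ x) (hxx' : x ≤ x') (hy : 0 ≤ y)
    (hyy' : y ≤ y') : (τ (x * y)).re ≤ (τ (x' * y')).re := by
  have hleft : τ (x * y) ≤ τ (x' * y) := by
    simpa [sub_mul] using τ.map_mul_nonneg (sub_nonneg.2 hxx') hy
  have hright : τ (x' * y) ≤ τ (x' * y') := by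
    simpa [mul_sub] using τ.map_mul_nonneg (hx.trans hxx') (sub_nonneg.2 hyy')
  exact (Complex.le_def.1 (hleft.trans hright)).1

theorem isSelfAdjoint_of_forall_map_mul_nonneg {x : M} (h : ∀ m, 0 ≤ m → 0 ≤ τ (x * m)) :
    IsSelfAdjoint x := by
  let φ : M →ₚ[ℂ] ℂ := PositiveLinearMap.mk₀ (τ.toDual x) h
  refine τ.ext_mul_right fun m => ?_
  calc τ (star x * m) = star (τ (x * star m)) := by
        rw [τ.map_mul_comm, ← τ.map_star, star_mul, star_star]
    _ = τ (x * m) := by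
      have hφ : φ (star m) = star (φ m) := StarHomClass.map_star φ m
      exact star_eq_iff_star_eq.2 hφ.symm

theorem nonneg_of_forall_map_mul_nonneg {x : M} (h : ∀ m, 0 ≤ m → 0 ≤ τ (x * m)) : 0 ≤ x := by
  have hx := τ.isSelfAdjoint_of_forall_map_mul_nonneg h
  have hneg : 0 ≤ x⁻ := CFC.negPart_nonneg x
  have hsq : x * x⁻ = -(star x⁻ * x⁻) := by
    rw [hneg.isSelfAdjoint.star_eq]
    nth_rw 1 [← CFC.posPart_sub_negPart x hx]
    rw [sub_mul, CFC.posPart_mul_negPart, zero_sub]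
  have hτ : τ (star x⁻ * x⁻) = 0 := by
    refine le_antisymm ?_ (τ.map_nonneg (star_mul_self_nonneg _))
    simpa [hsq] using h _ hneg
  have hzero : x⁻ = 0 :=
    CStarRing.star_mul_self_eq_zero_iff _ |>.1 (τ.faithful' _ (star_mul_self_nonneg _) hτ)
  rw [← CFC.posPart_sub_negPart x hx, hzero, sub_zero]
  exact CFC.posPart_nonneg x

theorem norm_map_star_mul_le (x y : M) :
    ‖τ (star x * y)‖ ≤ √(τ (star x * x)).re * √(τ (star y * y)).re :=
  norm_inner_le_norm (𝕜 := ℂ) (τ.toPositiveLinearMap.toPreGNS x) (τ.toPositiveLinearMap.toPreGNS y)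

theorem norm_map_mul_le {x : M} (hx : 0 ≤ x) (y : M) : ‖τ (x * y)‖ ≤ (τ x).re * ‖y‖ := by
  obtain ⟨s, rfl⟩ := CStarAlgebra.nonneg_iff_eq_mul_star_self.1 hx
  have hy : (τ (star (y * s) * (y * s))).re ≤ (τ (s * star s)).re * ‖y‖ ^ 2 := by
    have hle : star y * y ≤ algebraMap ℝ M (‖y‖ ^ 2) := by
      simpa [sq, CStarRing.norm_star_mul_self] using
        IsSelfAdjoint.le_algebraMap_norm_self (IsSelfAdjoint.star_mul_self y)
    have := τ.re_map_mono (star_left_conjugate_le_conjugate hle s)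
    rw [Algebra.algebraMap_eq_smul_one, mul_smul_comm, mul_one, smul_mul_assoc,
      τ.re_map_real_smul, τ.map_mul_comm (star s)] at this
    rw [mul_comm]
    simpa only [star_mul, mul_assoc] using this
  calc ‖τ (s * star s * y)‖ = ‖τ (star s * (y * s))‖ := by
        rw [mul_assoc, τ.map_mul_comm, mul_assoc]
    _ ≤ √(τ (star s * s)).re * √(τ (star (y * s) * (y * s))).re := τ.norm_map_star_mul_le s (y * s)
    _ ≤ √(τ (s * star s)).re * √((τ (s * star s)).re * ‖y‖ ^ 2) := by
      rw [τ.map_mul_comm (star s)]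
      gcongr
    _ = (τ (s * star s)).re * ‖y‖ := by
      rw [Real.sqrt_mul (τ.re_map_nonneg hx), Real.sqrt_sq (norm_nonneg y), ← mul_assoc,
        Real.mul_self_sqrt (τ.re_map_nonneg hx)]

theorem exists_norm_le_mul_re_map [FiniteDimensional ℂ M] :
    ∃ C : ℝ, 0 ≤ C ∧ ∀ x : M, 0 ≤ x → ‖x‖ ≤ C * (τ x).re := by
  let D : M →ₗ[ℂ] M →L[ℂ] ℂ := LinearMap.toContinuousLinearMap.toLinearMap ∘ₗ τ.toDual
  obtain ⟨C, -, hC⟩ := D.exists_antilipschitzWith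
    (LinearMap.ker_eq_bot.2 (LinearMap.toContinuousLinearMap.injective.comp τ.toDual_injective))
  refine ⟨C, C.2, fun x hx => (hC.le_mul_norm (map_zero D) x).trans ?_⟩
  gcongr
  exact ContinuousLinearMap.opNorm_le_bound _ (τ.re_map_nonneg hx) (τ.norm_map_mul_le hx)

end FaithfulTrace

section CompletelyPositive

open scoped CStarAlgebra

/-- Stated for a bundled C⋆-algebra: instance search does not find the continuous functional
calculus on `CStarMatrix n n N` that `CStarAlgebra.nonneg_iff_eq_star_mul_self` asks for. -/
theorem exists_eq_star_mul_self {A : Type*} [NonUnitalCStarAlgebra A] [PartialOrder A]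
    [StarOrderedRing A] {x : A} (hx : 0 ≤ x) : ∃ s, x = star s * s :=
  CStarAlgebra.nonneg_iff_eq_star_mul_self.1 hx

variable {M N n : Type*} [CStarAlgebra M] [PartialOrder M] [StarOrderedRing M]
  [CStarAlgebra N] [PartialOrder N] [StarOrderedRing N] [Fintype n]

theorem sum_star_mul_mul_nonneg {X : CStarMatrix n n N} (hX : 0 ≤ X) (w : n → N) :
    0 ≤ ∑ i, ∑ j, star (w i) * X i j * w j := by
  obtain ⟨S, rfl⟩ := exists_eq_star_mul_self hX
  have hentry (i j : n) : star (w i) * (star S * S) i j * w j =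
      ∑ l, star (S l i * w i) * (S l j * w j) := by
    simp only [CStarMatrix.mul_apply, CStarMatrix.star_apply, Finset.mul_sum, Finset.sum_mul,
      star_mul, mul_assoc]
  have hsum : ∑ i, ∑ j, star (w i) * (star S * S) i j * w j =
      ∑ l, star (∑ i, S l i * w i) * ∑ j, S l j * w j := by
    simp_rw [hentry, star_sum, Finset.sum_mul_sum]
    rw [Finset.sum_congr rfl fun i _ => Finset.sum_comm, Finset.sum_comm]
  rw [hsum]
  exact Finset.sum_nonneg fun l _ => star_mul_self_nonneg _

theorem gram_nonneg (p : n → M) :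
    0 ≤ (CStarMatrix.ofMatrix fun i j => star (p i) * p j : CStarMatrix n n M) := by
  classical
  rcases isEmpty_or_nonempty n with _ | ⟨⟨i₀⟩⟩
  · exact le_of_eq (CStarMatrix.ext fun i => isEmptyElim i)
  · let S : CStarMatrix n n M := CStarMatrix.ofMatrix fun i j => if i = i₀ then p j else 0
    have hS (i j : n) : S i j = if i = i₀ then p j else 0 := rfl
    convert star_mul_self_nonneg S
    ext i j
    simp only [CStarMatrix.mul_apply, CStarMatrix.star_apply, hS, mul_ite, mul_zero,
      Finset.sum_ite_eq', Finset.mem_univ, ↓reduceIte]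
    rfl

theorem sum_star_mul_map_mul_nonneg (Φ : M →CP N) (p : n → M) (w : n → N) :
    0 ≤ ∑ i, ∑ j, star (w i) * Φ (star (p i) * p j) * w j :=
  sum_star_mul_mul_nonneg (Φ.map_cstarMatrix_nonneg _ (gram_nonneg p)) w

end CompletelyPositive

/-- A unital linear map satisfying the Kadison–Schwarz inequality; such a map is positive. These
are the only properties of the adjoint of a quantum channel that the interpolation uses. -/
structure IsSchwarzMap {M N : Type*} [CStarAlgebra M] [PartialOrder M] [CStarAlgebra N]
    (T : N →ₗ[ℂ] M) : Prop where
  map_one : T 1 = 1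
  star_map_mul_map_le (x : N) : star (T x) * T x ≤ T (star x * x)

namespace IsSchwarzMap

variable {M N : Type*} [CStarAlgebra M] [PartialOrder M] [CStarAlgebra N] {T : N →ₗ[ℂ] M}
  (hT : IsSchwarzMap T)

include hT

theorem map_algebraMap (r : ℝ) : T (algebraMap ℝ N r) = algebraMap ℝ M r := by
  rw [Algebra.algebraMap_eq_smul_one, Algebra.algebraMap_eq_smul_one, ← Complex.coe_smul, map_smul,
    hT.map_one, Complex.coe_smul]

variable [StarOrderedRing M] [PartialOrder N] [StarOrderedRing N]

protected theorem map_nonneg {x : N} (hx : 0 ≤ x) : 0 ≤ T x := by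
  obtain ⟨s, rfl⟩ := CStarAlgebra.nonneg_iff_eq_star_mul_self.1 hx
  exact (star_mul_self_nonneg _).trans (hT.star_map_mul_map_le s)

theorem map_mono {x y : N} (hxy : x ≤ y) : T x ≤ T y := by
  simpa using hT.map_nonneg (sub_nonneg.2 hxy)

protected theorem map_star (x : N) : T (star x) = star (T x) :=
  StarHomClass.map_star (PositiveLinearMap.mk₀ T fun _ => hT.map_nonneg) x

protected theorem continuous : Continuous T :=
  map_continuous (PositiveLinearMap.mk₀ T fun _ => hT.map_nonneg)

theorem map_mul_star_map_le (x : N) : T x * star (T x) ≤ T (x * star x) := by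
  simpa [hT.map_star] using hT.star_map_mul_map_le (star x)

theorem norm_map_le (x : N) : ‖T x‖ ≤ ‖x‖ := by
  have hle : star (T x) * T x ≤ algebraMap ℝ M ‖star x * x‖ :=
    calc star (T x) * T x ≤ T (star x * x) := hT.star_map_mul_map_le x
      _ ≤ T (algebraMap ℝ N ‖star x * x‖) := hT.map_mono
        (IsSelfAdjoint.le_algebraMap_norm_self (.star_mul_self x))
      _ = algebraMap ℝ M ‖star x * x‖ := hT.map_algebraMap _
  have := CStarAlgebra.norm_le_iff_le_algebraMap (star (T x) * T x) (norm_nonneg (star x * x))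
    (star_mul_self_nonneg _) |>.2 hle
  rw [CStarRing.norm_star_mul_self, CStarRing.norm_star_mul_self] at this
  exact (mul_self_le_mul_self_iff (norm_nonneg _) (norm_nonneg _)).2 this

theorem isStrictlyPositive_map {x : N} (hx : IsStrictlyPositive x) : IsStrictlyPositive (T x) := by
  rcases subsingleton_or_nontrivial N with _ | _
  · rw [Subsingleton.elim x 1, hT.map_one]
    exact isStrictlyPositive_one
  · obtain ⟨r, hr, hrx⟩ :=
      (CFC.exists_pos_algebraMap_le_iff hx.isSelfAdjoint).2 fun _ => hx.spectrum_pos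
    exact (isStrictlyPositive_algebraMap hr).of_le (hT.map_algebraMap r ▸ hT.map_mono hrx)

end IsSchwarzMap

section Adjoint

variable {M N : Type*} [CStarAlgebra M] [PartialOrder M] [StarOrderedRing M]
  [CStarAlgebra N] [PartialOrder N] [StarOrderedRing N]
  {τM : FaithfulTrace M} {τN : FaithfulTrace N}

theorem IsDensity.nontrivial {ρ : M} (hρ : IsDensity τM ρ) : Nontrivial M :=
  nontrivial_of_ne ρ 0 fun h => by simpa [h] using hρ.2

theorem traceAdjoint_nonneg [FiniteDimensional ℂ M] {Φ : M →ₗ[ℂ] N}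
    (hΦ : ∀ x, 0 ≤ x → 0 ≤ Φ x) {y : N} (hy : 0 ≤ y) : 0 ≤ traceAdjoint τM τN Φ y :=
  τM.nonneg_of_forall_map_mul_nonneg fun x hx => by
    rw [traceAdjoint_spec]
    exact τN.map_mul_nonneg hy (hΦ x hx)

namespace QuantumChannel

variable (Φ : QuantumChannel τM τN)

protected theorem map_nonneg {x : M} (hx : 0 ≤ x) : 0 ≤ Φ x :=
  map_nonneg Φ.toCompletelyPositiveMap hx

theorem trace_map (x : M) : τN (Φ x) = τM x :=
  Φ.trace_preserving' x

variable [FiniteDimensional ℂ M]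

theorem trace_adjoint_mul (y : N) (x : M) : τM (Φ.adjoint y * x) = τN (y * Φ x) :=
  traceAdjoint_spec τM τN Φ.toLinearMap y x

theorem adjoint_one : Φ.adjoint 1 = 1 :=
  τM.ext_mul_right fun x => by rw [Φ.trace_adjoint_mul, one_mul, one_mul, Φ.trace_map]

theorem adjoint_star (y : N) : Φ.adjoint (star y) = star (Φ.adjoint y) :=
  StarHomClass.map_star (PositiveLinearMap.mk₀ Φ.adjoint fun _ =>
    traceAdjoint_nonneg fun _ => Φ.map_nonneg) y

theorem sum_trace_adjoint_mul_nonneg {n : Type*} [Fintype n] (p : n → M) (w : n → N) :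
    0 ≤ ∑ i, ∑ j, τM (Φ.adjoint (w j * star (w i)) * (star (p i) * p j)) := by
  have h := τN.map_nonneg (sum_star_mul_map_mul_nonneg Φ.toCompletelyPositiveMap p w)
  simp only [map_sum] at h
  refine h.trans_eq (Finset.sum_congr rfl fun i _ => Finset.sum_congr rfl fun j _ => ?_)
  rw [Φ.trace_adjoint_mul, τN.map_mul_comm, ← mul_assoc]
  rfl

theorem isSchwarzMap_adjoint : IsSchwarzMap Φ.adjoint where
  map_one := Φ.adjoint_one
  star_map_mul_map_le y := by
    refine sub_nonneg.1 (τM.nonneg_of_forall_map_mul_nonneg fun m hm => ?_)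
    obtain ⟨s, rfl⟩ := CStarAlgebra.nonneg_iff_eq_star_mul_self.1 hm
    set t := Φ.adjoint y with ht
    -- The second column of the Gram matrix is the choice that completes the square.
    have hgram := Φ.sum_trace_adjoint_mul_nonneg ![s, -(s * star t)] ![star y, 1]
    have hcross : τM (t * (star s * (s * star t))) = τM (star t * (t * (star s * s))) := by
      rw [τM.map_mul_comm (star t)]
      simp only [mul_assoc]
    simp only [Fin.sum_univ_two, Matrix.cons_val_zero, Matrix.cons_val_one, star_star, star_one,
      one_mul, mul_one, star_neg, star_mul, neg_mul, mul_neg, neg_neg, map_neg, mul_assoc,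
      Φ.adjoint_one, Φ.adjoint_star, ← ht, hcross] at hgram
    simpa [sub_mul, mul_assoc] using hgram

end QuantumChannel

end Adjoint

section Embedding

variable {A R : Type*} [CStarAlgebra A] [PartialOrder A] [StarOrderedRing A]
  [CStarAlgebra R] [PartialOrder R] [StarOrderedRing R] [FiniteDimensional ℂ R]
  {τA : FaithfulTrace A} {τR : FaithfulTrace R} {ι : R →⋆ₐ[ℂ] A}

theorem trace_embeddingAdjoint_mul (a : A) (x : R) :
    τR (embeddingAdjoint τR τA ι a * x) = τA (a * ι x) :=
  traceAdjoint_spec τR τA (ι : R →ₐ[ℂ] A).toLinearMap a x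

theorem trace_embeddingAdjoint (a : A) : τR (embeddingAdjoint τR τA ι a) = τA a := by
  simpa using trace_embeddingAdjoint_mul (τA := τA) (τR := τR) (ι := ι) a 1

theorem embeddingAdjoint_nonneg {a : A} (ha : 0 ≤ a) : 0 ≤ embeddingAdjoint τR τA ι a :=
  traceAdjoint_nonneg (fun _ => map_nonneg ι) ha

theorem embeddingAdjoint_mul_mul (r s : R) (a : A) :
    embeddingAdjoint τR τA ι (ι r * a * ι s) = r * embeddingAdjoint τR τA ι a * s := by
  refine τR.ext_mul_right fun x => ?_
  calc τR (embeddingAdjoint τR τA ι (ι r * a * ι s) * x)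
      = τA (ι r * (a * (ι s * ι x))) := by rw [trace_embeddingAdjoint_mul, mul_assoc, mul_assoc]
    _ = τA (a * ι (s * x * r)) := by rw [τA.map_mul_comm]; simp only [map_mul, mul_assoc]
    _ = τR (embeddingAdjoint τR τA ι a * (s * x * r)) := (trace_embeddingAdjoint_mul a _).symm
    _ = τR (r * embeddingAdjoint τR τA ι a * s * x) := by
      rw [mul_assoc r, mul_assoc r, τR.map_mul_comm r]
      simp only [mul_assoc]

theorem isStrictlyPositive_embeddingAdjoint_one (hι : Function.Injective ι) :
    IsStrictlyPositive (embeddingAdjoint τR τA ι 1) := by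
  set d := embeddingAdjoint τR τA ι 1
  have hd : 0 ≤ d := embeddingAdjoint_nonneg zero_le_one
  have hinj : Function.Injective (LinearMap.mulLeft ℂ d) := by
    refine (injective_iff_map_eq_zero _).2 fun x (hx : d * x = 0) => ?_
    have hτ : τA (star (ι (star x)) * ι (star x)) = 0 := by
      calc τA (star (ι (star x)) * ι (star x)) = τA (1 * ι (x * star x)) := by simp [map_star]
        _ = τR (d * x * star x) := by rw [← trace_embeddingAdjoint_mul (τR := τR), mul_assoc]
        _ = 0 := by rw [hx, zero_mul, map_zero]
    have hzero : ι (star x) = 0 := CStarRing.star_mul_self_eq_zero_iff _ |>.1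
      (τA.faithful' _ (star_mul_self_nonneg _) hτ)
    exact star_eq_zero.1 ((map_eq_zero_iff ι hι).1 hzero)
  obtain ⟨e, he⟩ := LinearMap.surjective_of_injective hinj 1
  have hleft : star e * d = 1 := by
    simpa [hd.isSelfAdjoint.star_eq] using congrArg star he
  exact ⟨hd, isUnit_iff_exists_and_exists.2 ⟨⟨e, he⟩, ⟨star e, hleft⟩⟩⟩

theorem exists_isStrictlyPositive_embeddingAdjoint_eq_one (hι : Function.Injective ι) :
    ∃ a : A, IsStrictlyPositive a ∧ embeddingAdjoint τR τA ι a = 1 := by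
  have hd := isStrictlyPositive_embeddingAdjoint_one (τA := τA) (τR := τR) hι
  obtain ⟨u, hu⟩ := hd.isUnit
  have hinv : (0 : R) ≤ ↑u⁻¹ := (CFC.inv_nonneg u).2 (hu ▸ hd.nonneg)
  refine ⟨ι ↑u⁻¹, IsStrictlyPositive.iff_of_unital.2 ⟨map_nonneg ι hinv, u⁻¹.isUnit.map ι⟩, ?_⟩
  simpa [← hu] using embeddingAdjoint_mul_mul (τA := τA) (τR := τR) (ι := ι) (↑u⁻¹) 1 1

end Embedding

theorem isDensity_inv_smul {M : Type*} [CStarAlgebra M] [PartialOrder M] [StarOrderedRing M]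
    (τ : FaithfulTrace M) {x : M} (hx : 0 ≤ x) (hx0 : x ≠ 0) :
    IsDensity τ ((τ x).re⁻¹ • x) := by
  have hpos := τ.re_map_pos hx hx0
  refine ⟨smul_nonneg (inv_nonneg.2 hpos.le) hx, ?_⟩
  rw [← Complex.coe_smul, map_smul, smul_eq_mul, ← τ.ofReal_re_map hx, ← Complex.ofReal_mul,
    Complex.ofReal_re, inv_mul_cancel₀ hpos.ne', Complex.ofReal_one]

section Overlap

variable {A B M R : Type*} [CStarAlgebra A] [PartialOrder A] [StarOrderedRing A]
  [CStarAlgebra B] [PartialOrder B] [StarOrderedRing B]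
  [CStarAlgebra M] [PartialOrder M] [StarOrderedRing M] [FiniteDimensional ℂ M]
  [CStarAlgebra R] [PartialOrder R] [StarOrderedRing R] [FiniteDimensional ℂ R]
  {τA : FaithfulTrace A} {τB : FaithfulTrace B} {τM : FaithfulTrace M} {τR : FaithfulTrace R}
  {ι : R →⋆ₐ[ℂ] A} (ΦA : QuantumChannel τM τA) (ΦB : QuantumChannel τM τB)

theorem inv_mul_re_trace_mem_overlapSet {a : A} {b : B} (ha : 0 ≤ a)
    (hEa : embeddingAdjoint τR τA ι a = 1) (hb : 0 ≤ b) (hb0 : b ≠ 0) :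
    (τB b).re⁻¹ * (τM (ΦA.adjoint a * ΦB.adjoint b)).re ∈ overlapSet τR ι ΦA ΦB := by
  refine ⟨a, _, ha, hEa, isDensity_inv_smul τB hb hb0, ?_⟩
  rw [LinearMap.map_smul_of_tower, mul_smul_comm, τM.re_map_real_smul]

theorem exists_pos_mem_overlapSet [Nontrivial M] (hι : Function.Injective ι) :
    ∃ t ∈ overlapSet τR ι ΦA ΦB, 0 < t := by
  obtain ⟨a, ha, hEa⟩ :=
    exists_isStrictlyPositive_embeddingAdjoint_eq_one (τA := τA) (τR := τR) hι
  have hB : (1 : B) ≠ 0 := fun h => by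
    simpa [h] using ΦB.adjoint_one
  refine ⟨_, inv_mul_re_trace_mem_overlapSet ΦA ΦB ha.nonneg hEa zero_le_one hB, ?_⟩
  have ha' := ΦA.isSchwarzMap_adjoint.isStrictlyPositive_map ha
  rw [ΦB.adjoint_one, mul_one]
  exact mul_pos (inv_pos.2 (τB.re_map_pos zero_le_one hB))
    (τM.re_map_pos ha'.nonneg ha'.isUnit.ne_zero)

theorem bddAbove_overlapSet : BddAbove (overlapSet τR ι ΦA ΦB) := by
  obtain ⟨C, hC, hnorm⟩ := τM.exists_norm_le_mul_re_map
  let φ : M →L[ℂ] B := ΦB.toLinearMap.toContinuousLinearMap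
  refine ⟨‖φ‖ * (C * ((τR 1).re * ‖ΦA 1‖)), ?_⟩
  rintro t ⟨a, b, ha, hEa, ⟨hb, hb1⟩, rfl⟩
  have htrace : (τM (ΦA.adjoint a)).re ≤ (τR 1).re * ‖ΦA 1‖ :=
    calc (τM (ΦA.adjoint a)).re = (τA (a * ΦA 1)).re := by rw [← ΦA.trace_adjoint_mul, mul_one]
      _ ≤ (τA a).re * ‖ΦA 1‖ := (Complex.re_le_norm _).trans (τA.norm_map_mul_le ha _)
      _ = (τR 1).re * ‖ΦA 1‖ := by rw [← hEa, trace_embeddingAdjoint]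
  calc (τM (ΦA.adjoint a * ΦB.adjoint b)).re
      = (τB (b * φ (ΦA.adjoint a))).re := by rw [τM.map_mul_comm, ΦB.trace_adjoint_mul]; rfl
    _ ≤ (τB b).re * ‖φ (ΦA.adjoint a)‖ := (Complex.re_le_norm _).trans (τB.norm_map_mul_le hb _)
    _ = ‖φ (ΦA.adjoint a)‖ := by rw [hb1, Complex.one_re, one_mul]
    _ ≤ ‖φ‖ * ‖ΦA.adjoint a‖ := φ.le_opNorm _
    _ ≤ ‖φ‖ * (C * (τM (ΦA.adjoint a)).re) := by
      gcongr
      exact hnorm _ (ΦA.isSchwarzMap_adjoint.map_nonneg ha)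
    _ ≤ ‖φ‖ * (C * ((τR 1).re * ‖ΦA 1‖)) := by gcongr

theorem isLUB_overlapConst [Nontrivial M] (hι : Function.Injective ι) :
    IsLUB (overlapSet τR ι ΦA ΦB) (overlapConst τR ι ΦA ΦB) :=
  have ⟨t, ht, _⟩ := exists_pos_mem_overlapSet (τR := τR) ΦA ΦB hι
  isLUB_csSup ⟨t, ht⟩ (bddAbove_overlapSet ΦA ΦB)

theorem overlapConst_pos [Nontrivial M] (hι : Function.Injective ι) :
    0 < overlapConst τR ι ΦA ΦB :=
  have ⟨_, ht, hpos⟩ := exists_pos_mem_overlapSet (τR := τR) ΦA ΦB hι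
  hpos.trans_le (le_csSup (bddAbove_overlapSet ΦA ΦB) ht)

theorem re_trace_adjoint_mul_adjoint_le {a : A} {b : B} (ha : 0 ≤ a)
    (hEa : embeddingAdjoint τR τA ι a = 1) (hb : 0 ≤ b) :
    (τM (ΦA.adjoint a * ΦB.adjoint b)).re ≤ overlapConst τR ι ΦA ΦB * (τB b).re := by
  rcases eq_or_ne b 0 with rfl | hb0
  · simp
  · have := le_csSup (bddAbove_overlapSet ΦA ΦB)
      (inv_mul_re_trace_mem_overlapSet ΦA ΦB ha hEa hb hb0)
    rwa [inv_mul_le_iff₀ (τB.re_map_pos hb hb0), mul_comm] at this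

end Overlap

section ExponentialCurve

open NormedSpace

variable {M : Type*} [CStarAlgebra M]

open scoped CStarAlgebra in
theorem map_exp_starAlgHom {N : Type*} [CStarAlgebra N] (f : N →⋆ₐ[ℂ] M) (x : N) :
    f (exp x) = exp (f x) := by
  let _ : NormedAlgebra ℚ N := .restrictScalars ℚ ℂ N
  let _ : NormedAlgebra ℚ M := .restrictScalars ℚ ℂ M
  exact NormedSpace.map_exp f (map_continuous f) x

theorem exp_add_smul (L : M) (z w : ℂ) : exp ((z + w) • L) = exp (z • L) * exp (w • L) := by
  let _ : NormedAlgebra ℚ M := .restrictScalars ℚ ℂ M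
  rw [add_smul]
  exact exp_add_of_commute (((Commute.refl L).smul_left z).smul_right w)

theorem differentiable_exp_smul (L : M) : Differentiable ℂ fun z : ℂ => exp (z • L) :=
  fun z => (hasDerivAt_exp_smul_const L z).differentiableAt

theorem hasDerivAt_exp_smul_zero (L : M) : HasDerivAt (fun z : ℂ => exp (z • L)) L 0 := by
  simpa using hasDerivAt_exp_smul_const (𝕂 := ℂ) L 0

variable {L : M} (hL : IsSelfAdjoint L)

include hL

theorem star_exp_smul (z : ℂ) : star (exp (z • L)) = exp (star z • L) := by
  rw [star_exp, star_smul, hL.star_eq]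

theorem star_exp_smul_mul_exp_smul (z : ℂ) :
    star (exp (z • L)) * exp (z • L) = exp ((2 * z.re) • L) := by
  rw [star_exp_smul hL, ← exp_add_smul, ← Complex.coe_smul, Complex.star_def, add_comm,
    Complex.add_conj, Complex.ofReal_mul, Complex.ofReal_ofNat]

theorem exp_smul_mul_star_exp_smul (z : ℂ) :
    exp (z • L) * star (exp (z • L)) = exp ((2 * z.re) • L) := by
  rw [star_exp_smul hL, ← exp_add_smul, ← Complex.coe_smul, Complex.star_def, Complex.add_conj,
    Complex.ofReal_mul, Complex.ofReal_ofNat]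

theorem norm_exp_le_exp_norm : ‖exp L‖ ≤ Real.exp ‖L‖ := by
  rcases subsingleton_or_nontrivial M with _ | _
  · rw [Subsingleton.elim (exp L) 0, norm_zero]
    exact Real.exp_nonneg _
  rw [← CFC.real_exp_eq_normedSpace_exp hL]
  refine norm_cfc_le (Real.exp_nonneg _) fun t ht => ?_
  rw [Real.norm_eq_abs, Real.abs_exp]
  gcongr
  exact (le_abs_self t).trans (spectrum.norm_le_norm_of_mem ht)

theorem norm_exp_smul_le (z : ℂ) : ‖exp (z • L)‖ ≤ Real.exp (|z.re| * ‖L‖) := by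
  have hsa : IsSelfAdjoint ((2 * z.re) • L) := (IsSelfAdjoint.all _).smul hL
  refine le_of_sq_le_sq ?_ (Real.exp_nonneg _)
  calc ‖exp (z • L)‖ ^ 2 = ‖exp ((2 * z.re) • L)‖ := by
        rw [sq, ← CStarRing.norm_star_mul_self, star_exp_smul_mul_exp_smul hL]
    _ ≤ Real.exp ‖(2 * z.re) • L‖ := norm_exp_le_exp_norm hsa
    _ = Real.exp (|z.re| * ‖L‖) ^ 2 := by
      rw [norm_smul, Real.norm_eq_abs, abs_mul, abs_two, mul_assoc, two_mul, Real.exp_add, sq]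

end ExponentialCurve

theorem re_deriv_le_log_div_of_strip {F : ℂ → ℂ} {F' : ℂ} {K u : ℝ} (hK : 0 < K) (hu : 0 < u)
    (hF : Differentiable ℂ F)
    (hB : BddAbove ((norm ∘ F) '' Complex.HadamardThreeLines.verticalClosedStrip 0 u))
    (hleft : ∀ z : ℂ, z.re = 0 → ‖F z‖ ≤ 1) (hright : ∀ z : ℂ, z.re = u → ‖F z‖ ≤ K)
    (hF0 : F 0 = 1) (hF' : HasDerivAt F F' 0) : F'.re ≤ Real.log K / u := by
  let g (x : ℝ) : ℝ := K ^ (x / u) - (F x).re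
  have hg : ∀ x ∈ Set.Icc 0 u, 0 ≤ g x := by
    intro x hx
    have := Complex.HadamardThreeLines.norm_le_interp_of_mem_verticalClosedStrip' (z := (x : ℂ)) hu
      (by simpa [Complex.HadamardThreeLines.verticalClosedStrip] using hx) hF.diffContOnCl hB
      hleft hright
    rw [Real.one_rpow, one_mul, Complex.ofReal_re, sub_zero, sub_zero] at this
    exact sub_nonneg.2 ((Complex.re_le_norm _).trans this)
  have hg' : HasDerivAt g (Real.log K / u - F'.re) 0 := by
    have hpow := ((hasDerivAt_id (0 : ℝ)).div_const u).const_rpow hK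
    have hF'ofReal : HasDerivAt F F' ((0 : ℝ) : ℂ) := by simpa using hF'
    refine (hpow.congr_deriv ?_).sub hF'ofReal.real_of_complex
    simp [div_eq_mul_inv]
  have hslope := hg'.hasDerivWithinAt (s := Set.Ioi 0)
  rw [hasDerivWithinAt_iff_tendsto_slope' (by simp)] at hslope
  refine sub_nonneg.1 (ge_of_tendsto hslope ?_)
  filter_upwards [Ioo_mem_nhdsGT hu] with x hx
  have hg0 : g 0 = 0 := by simp [g, hF0]
  rw [slope_def_field, hg0, sub_zero, sub_zero]
  exact div_nonneg (hg x ⟨hx.1.le, hx.2.le⟩) hx.1.le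

section Interpolation

open NormedSpace

variable {A B M : Type*} [CStarAlgebra A] [CStarAlgebra B] [CStarAlgebra M]
  [PartialOrder M] [StarOrderedRing M]

/-- The analytic family `z ↦ τ(ρ e^{zH} S(e^{zK}) T(e^{zL} e^{zL'}))` to which the three lines
theorem is applied; the entropies appear in its derivative at `0`. -/
def interpolant (τ : FaithfulTrace M) (S : B →ₗ[ℂ] M) (T : A →ₗ[ℂ] M) (ρ H : M) (K : B)
    (L L' : A) (z : ℂ) : ℂ :=
  τ (ρ * (exp (z • H) * S (exp (z • K)) * T (exp (z • L) * exp (z • L'))))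

variable {τ : FaithfulTrace M} {S : B →ₗ[ℂ] M} {T : A →ₗ[ℂ] M} (hS : IsSchwarzMap S)
  (hT : IsSchwarzMap T) {ρ H : M} {K : B} {L L' : A}

include hS hT

theorem interpolant_zero (hρ : IsDensity τ ρ) : interpolant τ S T ρ H K L L' 0 = 1 := by
  simp [interpolant, hS.map_one, hT.map_one, hρ.2]

variable [PartialOrder A] [StarOrderedRing A]

theorem norm_trace_mul_map_mul_map_le (W : M) (y : B) (v : A) :
    ‖τ (W * (S y * T v))‖ ≤
      √(τ (W * star W)).re * √(τ (T (v * star v) * S (star y * y))).re := by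
  have hcyclic : τ (star (S y * T v) * (S y * T v)) =
      τ (T v * star (T v) * (star (S y) * S y)) := by
    rw [τ.map_mul_comm (T v * _), ← mul_assoc _ (T v), τ.map_mul_comm _ (star (T v))]
    simp only [star_mul, mul_assoc]
  calc ‖τ (W * (S y * T v))‖
      ≤ √(τ (W * star W)).re * √(τ (star (S y * T v) * (S y * T v))).re := by
        simpa using τ.norm_map_star_mul_le (star W) (S y * T v)
    _ ≤ √(τ (W * star W)).re * √(τ (T (v * star v) * S (star y * y))).re := by
      rw [hcyclic]
      exact mul_le_mul_of_nonneg_left (Real.sqrt_le_sqrt (τ.re_map_mul_mono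
        (mul_star_self_nonneg _) (hT.map_mul_star_map_le v) (star_mul_self_nonneg _)
        (hS.star_map_mul_map_le y))) (Real.sqrt_nonneg _)

variable [PartialOrder B] [StarOrderedRing B]

variable (τ ρ H K L L') in
theorem differentiable_interpolant : Differentiable ℂ (interpolant τ S T ρ H K L L') := by
  let τc : M →L[ℂ] ℂ := ⟨τ.toLinearMap, τ.continuous⟩
  let Sc : B →L[ℂ] M := ⟨S, hS.continuous⟩
  let Tc : A →L[ℂ] M := ⟨T, hT.continuous⟩
  exact τc.differentiable.comp ((differentiable_const ρ).mul
    (((differentiable_exp_smul H).mul (Sc.differentiable.comp (differentiable_exp_smul K))).mul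
      (Tc.differentiable.comp ((differentiable_exp_smul L).mul (differentiable_exp_smul L')))))

variable (τ ρ H K L L') in
theorem hasDerivAt_interpolant_zero :
    HasDerivAt (interpolant τ S T ρ H K L L') (τ (ρ * (H + S K + T (L + L')))) 0 := by
  let τc : M →L[ℂ] ℂ := ⟨τ.toLinearMap, τ.continuous⟩
  let Sc : B →L[ℂ] M := ⟨S, hS.continuous⟩
  let Tc : A →L[ℂ] M := ⟨T, hT.continuous⟩
  have hSexp := Sc.hasFDerivAt.comp_hasDerivAt 0 (hasDerivAt_exp_smul_zero K)
  have hTexp := Tc.hasFDerivAt.comp_hasDerivAt 0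
    ((hasDerivAt_exp_smul_zero L).mul (hasDerivAt_exp_smul_zero L'))
  have h := τc.hasFDerivAt.comp_hasDerivAt 0
    ((((hasDerivAt_exp_smul_zero H).mul hSexp).mul hTexp).const_mul ρ)
  refine h.congr_deriv ?_
  simp [τc, Sc, Tc, hS.map_one, hT.map_one]

theorem norm_interpolant_le (hρ : IsDensity τ ρ) (hH : IsSelfAdjoint H) (hK : IsSelfAdjoint K)
    (hL : IsSelfAdjoint L) (hL' : IsSelfAdjoint L') (z : ℂ) :
    ‖interpolant τ S T ρ H K L L' z‖ ≤ Real.exp (|z.re| * (‖H‖ + ‖K‖ + (‖L‖ + ‖L'‖))) :=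
  calc ‖interpolant τ S T ρ H K L L' z‖
      ≤ (τ ρ).re * ‖exp (z • H) * S (exp (z • K)) * T (exp (z • L) * exp (z • L'))‖ :=
        τ.norm_map_mul_le hρ.1 _
    _ = ‖exp (z • H) * S (exp (z • K)) * T (exp (z • L) * exp (z • L'))‖ := by
      rw [hρ.2, Complex.one_re, one_mul]
    _ ≤ ‖exp (z • H)‖ * ‖exp (z • K)‖ * (‖exp (z • L)‖ * ‖exp (z • L')‖) := by
      refine (norm_mul_le _ _).trans (mul_le_mul ((norm_mul_le _ _).trans ?_)
        ((hT.norm_map_le _).trans (norm_mul_le _ _)) (norm_nonneg _) (by positivity))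
      gcongr
      exact hS.norm_map_le _
    _ ≤ Real.exp (|z.re| * ‖H‖) * Real.exp (|z.re| * ‖K‖) *
          (Real.exp (|z.re| * ‖L‖) * Real.exp (|z.re| * ‖L'‖)) := by
      gcongr <;> exact norm_exp_smul_le ‹_› z
    _ = Real.exp (|z.re| * (‖H‖ + ‖K‖ + (‖L‖ + ‖L'‖))) := by
      simp only [mul_add, Real.exp_add]

theorem re_trace_mul_add_le_log {C : ℝ} (hC : 0 < C) (hρ : IsDensity τ ρ) (hH : IsSelfAdjoint H)
    (hK : IsSelfAdjoint K) (hL : IsSelfAdjoint L) (hL' : IsSelfAdjoint L')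
    (hexpH : (τ (ρ * exp H * ρ)).re ≤ 1)
    (hexpK : ∀ z : ℂ, z.re = 1 / 2 →
      (τ (T (exp (z • L) * exp (z • L') * star (exp (z • L) * exp (z • L'))) * S (exp K))).re ≤ C) :
    (τ (ρ * (H + S K + T (L + L')))).re ≤ Real.log C := by
  set F := interpolant τ S T ρ H K L L'
  have hnorm := norm_interpolant_le hS hT hρ hH hK hL hL'
  have hbdd :
      BddAbove ((norm ∘ F) '' Complex.HadamardThreeLines.verticalClosedStrip 0 (1 / 2)) := by
    refine ⟨Real.exp (1 / 2 * (‖H‖ + ‖K‖ + (‖L‖ + ‖L'‖))), ?_⟩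
    rintro _ ⟨z, hz, rfl⟩
    refine (hnorm z).trans ?_
    gcongr
    exact abs_le.2 ⟨by linarith [hz.1], hz.2⟩
  have hleft (z : ℂ) (hz : z.re = 0) : ‖F z‖ ≤ 1 := by
    simpa [hz] using hnorm z
  have hright (z : ℂ) (hz : z.re = 1 / 2) : ‖F z‖ ≤ √C := by
    have htwo : (2 * z.re) = 1 := by rw [hz]; norm_num
    have hW : ρ * exp (z • H) * star (ρ * exp (z • H)) = ρ * exp H * ρ := by
      rw [star_mul, hρ.1.isSelfAdjoint.star_eq, mul_assoc, ← mul_assoc (exp _),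
        exp_smul_mul_star_exp_smul hH, htwo, one_smul, mul_assoc]
    have hy : star (exp (z • K)) * exp (z • K) = exp K := by
      rw [star_exp_smul_mul_exp_smul hK, htwo, one_smul]
    have h := norm_trace_mul_map_mul_map_le hS hT (τ := τ) (ρ * exp (z • H)) (exp (z • K))
      (exp (z • L) * exp (z • L'))
    rw [hW, hy] at h
    calc ‖F z‖ ≤ _ := by simpa only [F, interpolant, mul_assoc] using h
      _ ≤ 1 * √C := mul_le_mul (Real.sqrt_le_one.2 hexpH) (Real.sqrt_le_sqrt (hexpK z hz))
        (Real.sqrt_nonneg _) zero_le_one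
      _ = √C := one_mul _
  have h := re_deriv_le_log_div_of_strip (Real.sqrt_pos.2 hC) one_half_pos
    (differentiable_interpolant τ hS hT ρ H K L L') hbdd hleft hright (interpolant_zero hS hT hρ)
    (hasDerivAt_interpolant_zero τ hS hT ρ H K L L')
  rwa [Real.log_sqrt hC.le, div_div_eq_mul_div, div_one, div_mul_cancel₀ _ two_ne_zero] at h

end Interpolation

section LogarithmBound

open NormedSpace

variable {A B M R : Type*} [CStarAlgebra A] [PartialOrder A] [StarOrderedRing A]
  [CStarAlgebra B] [PartialOrder B] [StarOrderedRing B]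
  [CStarAlgebra M] [PartialOrder M] [StarOrderedRing M]
  [CStarAlgebra R] [PartialOrder R] [StarOrderedRing R] [FiniteDimensional ℂ R]
  {τA : FaithfulTrace A} {τB : FaithfulTrace B} {τM : FaithfulTrace M} {τR : FaithfulTrace R}
  {ι : R →⋆ₐ[ℂ] A}

theorem mul_exp_neg_mul_le {x L : M} (hL : IsSelfAdjoint L) (hx : 0 ≤ x) (hxL : x ≤ exp L) :
    x * exp (-L) * x ≤ x := by
  set u := exp ((-(1 / 2) : ℂ) • L)
  set v := exp ((1 / 2 : ℂ) • L)
  have hu : star u = u := by simp only [u, star_exp_smul hL]; simp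
  have hv : star v = v := by simp only [v, star_exp_smul hL]; simp
  have huv : u * v = 1 := by rw [← exp_add_smul, neg_add_cancel, zero_smul, exp_zero]
  have hvu : v * u = 1 := by rw [← exp_add_smul, add_neg_cancel, zero_smul, exp_zero]
  have huu : u * u = exp (-L) := by
    rw [← exp_add_smul, ← neg_add, add_halves, neg_one_smul]
  have hvv : v * v = exp L := by rw [← exp_add_smul, add_halves, one_smul]
  have hp0 : 0 ≤ u * x * u := by simpa [hu] using star_left_conjugate_nonneg hx u
  have hp1 : u * x * u ≤ 1 :=
    calc u * x * u ≤ u * exp L * u := by simpa [hu] using star_left_conjugate_le_conjugate hxL u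
      _ = (u * v) * (v * u) := by rw [← hvv]; simp only [mul_assoc]
      _ = 1 := by rw [huv, hvu, one_mul]
  have hp := star_left_conjugate_le_conjugate (CStarAlgebra.pow_antitone hp0 hp1 one_le_two) v
  calc x * exp (-L) * x = (v * u) * x * (u * u) * x * (u * v) := by rw [huu, huv, hvu]; simp
    _ = star v * (u * x * u) ^ 2 * v := by rw [hv, sq]; simp only [mul_assoc]
    _ ≤ star v * (u * x * u) ^ 1 * v := hp
    _ = (v * u) * x * (u * v) := by rw [hv, pow_one]; simp only [mul_assoc]
    _ = x := by rw [huv, hvu, one_mul, mul_one]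

theorem embeddingAdjoint_exp_mul_star_eq_one {Lσ : A} {Lη : R} (hσ : IsSelfAdjoint Lσ)
    (hη : IsSelfAdjoint Lη) (hE : embeddingAdjoint τR τA ι (exp Lσ) = exp Lη) {z : ℂ}
    (hz : z.re = 1 / 2) :
    embeddingAdjoint τR τA ι
      (exp (z • ι (-Lη)) * exp (z • Lσ) * star (exp (z • ι (-Lη)) * exp (z • Lσ))) = 1 := by
  have hι : exp (z • ι (-Lη)) = ι (exp (z • -Lη)) := by rw [map_exp_starAlgHom, map_smul]
  have hsq : exp (z • Lσ) * star (exp (z • Lσ)) = exp Lσ := by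
    rw [exp_smul_mul_star_exp_smul hσ, hz, mul_one_div_cancel two_ne_zero, one_smul]
  have hsum : -z + 1 + -star z = 0 := by
    apply Complex.ext <;> norm_num [hz]
  calc embeddingAdjoint τR τA ι
        (exp (z • ι (-Lη)) * exp (z • Lσ) * star (exp (z • ι (-Lη)) * exp (z • Lσ)))
      = embeddingAdjoint τR τA ι (ι (exp (z • -Lη)) * exp Lσ * ι (star (exp (z • -Lη)))) := by
        rw [hι, star_mul, ← map_star, ← hsq]
        simp only [mul_assoc]
    _ = exp (z • -Lη) * exp Lη * star (exp (z • -Lη)) := by rw [embeddingAdjoint_mul_mul, hE]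
    _ = exp ((-z + 1 + -star z) • Lη) := by
      rw [star_exp_smul hη.neg, smul_neg, smul_neg, exp_add_smul, exp_add_smul, neg_smul, neg_smul,
        one_smul]
    _ = 1 := by rw [hsum, zero_smul, exp_zero]

theorem QuantumChannel.isDensity_map (Φ : QuantumChannel τM τA) {ρ : M} (hρ : IsDensity τM ρ) :
    IsDensity τA (Φ ρ) :=
  ⟨Φ.map_nonneg hρ.1, (Φ.trace_map ρ).trans hρ.2⟩

theorem re_trace_mul_add_re_trace_mul_le [FiniteDimensional ℂ M] (ΦA : QuantumChannel τM τA)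
    (ΦB : QuantumChannel τM τB) (hι : Function.Injective ι) {ρ Lρ : M} {Lω : B} {Lσ : A} {Lη : R}
    (hρ : IsDensity τM ρ) (hLρ : IsSelfAdjoint Lρ) (hLω : IsSelfAdjoint Lω)
    (hLσ : IsSelfAdjoint Lσ) (hLη : IsSelfAdjoint Lη) (hρL : ρ ≤ exp Lρ)
    (hE : embeddingAdjoint τR τA ι (exp Lσ) = exp Lη) :
    (τA (ΦA ρ * Lσ)).re + (τB (ΦB ρ * Lω)).re ≤
      (τM (ρ * Lρ)).re + (τR (embeddingAdjoint τR τA ι (ΦA ρ) * Lη)).re +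
        Real.log (overlapConst τR ι ΦA ΦB * (τB (exp Lω)).re) := by
  have := hρ.nontrivial
  have := (ΦB.isDensity_map hρ).nontrivial
  let _ : NormedAlgebra ℚ B := .restrictScalars ℚ ℂ B
  have hexpω : 0 ≤ exp Lω := hLω.exp_nonneg
  have hC : 0 < overlapConst τR ι ΦA ΦB * (τB (exp Lω)).re :=
    mul_pos (overlapConst_pos ΦA ΦB hι)
      (τB.re_map_pos hexpω (isUnit_exp Lω).ne_zero)
  have hexpρ : (τM (ρ * exp (-Lρ) * ρ)).re ≤ 1 := by
    simpa [hρ.2] using τM.re_map_mono (mul_exp_neg_mul_le hLρ hρ.1 hρL)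
  have h := re_trace_mul_add_le_log ΦB.isSchwarzMap_adjoint ΦA.isSchwarzMap_adjoint hC hρ hLρ.neg
    hLω (hLη.neg.map ι) hLσ hexpρ fun z hz => re_trace_adjoint_mul_adjoint_le ΦA ΦB
      (mul_star_self_nonneg _) (embeddingAdjoint_exp_mul_star_eq_one hLσ hLη hE hz) hexpω
  have hA : τM (ρ * ΦA.adjoint (ι (-Lη) + Lσ)) =
      τA (ΦA ρ * Lσ) - τR (embeddingAdjoint τR τA ι (ΦA ρ) * Lη) := by
    rw [τM.map_mul_comm, ΦA.trace_adjoint_mul, τA.map_mul_comm, mul_add, map_add,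
      ← trace_embeddingAdjoint_mul (τR := τR), mul_neg, map_neg, neg_add_eq_sub]
  have hB : τM (ρ * ΦB.adjoint Lω) = τB (ΦB ρ * Lω) := by
    rw [τM.map_mul_comm, ΦB.trace_adjoint_mul, τB.map_mul_comm]
  rw [mul_add, mul_add, map_add, map_add, hA, hB, mul_neg, map_neg] at h
  simp only [Complex.add_re, Complex.sub_re, Complex.neg_re] at h
  linarith

end LogarithmBound

theorem mul_log_add_le {t ε : ℝ} (ht : 0 ≤ t) (hε : 0 < ε) :
    t * Real.log (t + ε) ≤ t * Real.log t + ε := by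
  rcases ht.eq_or_lt with rfl | htpos
  · simpa using hε.le
  have hratio : 0 < 1 + ε / t := by positivity
  have hlog : Real.log (t + ε) ≤ Real.log t + ε / t :=
    calc Real.log (t + ε) = Real.log t + Real.log (1 + ε / t) := by
          rw [← Real.log_mul htpos.ne' hratio.ne', mul_add, mul_one, mul_div_cancel₀ _ htpos.ne']
      _ ≤ Real.log t + ε / t := by linarith [Real.log_le_sub_one_of_pos hratio]
  calc t * Real.log (t + ε) ≤ t * (Real.log t + ε / t) := by gcongr
    _ = t * Real.log t + ε := by rw [mul_add, mul_div_cancel₀ _ htpos.ne']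

theorem mul_log_le_mul_log_add {t ε : ℝ} (ht : 0 ≤ t) (hε : 0 ≤ ε) :
    t * Real.log t ≤ t * Real.log (t + ε) := by
  rcases ht.eq_or_lt with rfl | htpos
  · simp
  · gcongr
    exact le_add_of_nonneg_right hε

section Regularization

variable {M : Type*} [CStarAlgebra M] [PartialOrder M] [StarOrderedRing M] {x : M} {ε : ℝ}

theorem continuousOn_log_add_spectrum (hx : 0 ≤ x) (hε : 0 < ε) :
    ContinuousOn (fun t : ℝ => Real.log (t + ε)) (spectrum ℝ x) :=
  (continuousOn_id.add continuousOn_const).log fun _ ht =>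
    (add_pos_of_nonneg_of_pos (spectrum_nonneg_of_nonneg hx ht) hε).ne'

theorem mul_log_add_algebraMap (hx : 0 ≤ x) (hε : 0 < ε) :
    x * CFC.log (x + algebraMap ℝ M ε) = cfc (fun t : ℝ => t * Real.log (t + ε)) x := by
  have hsa := hx.isSelfAdjoint
  have hshift : x + algebraMap ℝ M ε = cfc (fun t : ℝ => t + ε) x := by
    rw [cfc_add_const ε (fun t : ℝ => t) x, cfc_id' ℝ x]
  have hcont : ContinuousOn Real.log ((fun t : ℝ => t + ε) '' spectrum ℝ x) := by
    refine Real.continuousOn_log.mono ?_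
    rintro _ ⟨t, ht, rfl⟩
    exact (add_pos_of_nonneg_of_pos (spectrum_nonneg_of_nonneg hx ht) hε).ne'
  rw [CFC.log, hshift, ← cfc_comp' Real.log (fun t : ℝ => t + ε) x hcont,
    cfc_mul (fun t : ℝ => t) _ x continuousOn_id (continuousOn_log_add_spectrum hx hε),
    cfc_id' ℝ x]

theorem exp_log_add {y : M} (hx : 0 ≤ x) (hy : IsStrictlyPositive y) :
    NormedSpace.exp (CFC.log (x + y)) = x + y :=
  CFC.exp_log _ (add_comm x y ▸ hy.add_nonneg hx)

variable (τ : FaithfulTrace M)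

theorem re_trace_mul_log_add_le (hx : 0 ≤ x) (hε : 0 < ε) :
    (τ (x * CFC.log (x + algebraMap ℝ M ε))).re ≤ -entropy τ x + ε * (τ 1).re := by
  have hsa := hx.isSelfAdjoint
  have hle : x * CFC.log (x + algebraMap ℝ M ε) ≤
      cfc (fun t : ℝ => t * Real.log t) x + algebraMap ℝ M ε := by
    rw [mul_log_add_algebraMap hx hε,
      ← cfc_add_const ε (fun t : ℝ => t * Real.log t) x Real.continuous_mul_log.continuousOn]
    exact cfc_mono (fun t ht => mul_log_add_le (spectrum_nonneg_of_nonneg hx ht) hε)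
      (continuousOn_id.mul (continuousOn_log_add_spectrum hx hε))
      (Real.continuous_mul_log.add continuous_const).continuousOn
  simpa [entropy, τ.re_map_algebraMap] using τ.re_map_mono hle

theorem neg_entropy_le_re_trace_mul_log_add_algebraMap (hx : 0 ≤ x) (hε : 0 < ε) :
    -entropy τ x ≤ (τ (x * CFC.log (x + algebraMap ℝ M ε))).re := by
  rw [entropy, neg_neg, mul_log_add_algebraMap hx hε]
  exact τ.re_map_mono <| cfc_mono
    (fun t ht => mul_log_le_mul_log_add (spectrum_nonneg_of_nonneg hx ht) hε.le)
    Real.continuous_mul_log.continuousOn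
    (continuousOn_id.mul (continuousOn_log_add_spectrum hx hε))

theorem neg_entropy_le_re_trace_mul_log_add (hx : 0 ≤ x) {y : M} (hy : IsStrictlyPositive y) :
    -entropy τ x ≤ (τ (x * CFC.log (x + y))).re := by
  rcases subsingleton_or_nontrivial M with _ | _
  · simp [entropy, Subsingleton.elim _ (0 : M)]
  obtain ⟨r, hr, hry⟩ :=
    (CFC.exists_pos_algebraMap_le_iff hy.isSelfAdjoint).2 fun _ => hy.spectrum_pos
  have hlog : CFC.log (x + algebraMap ℝ M r) ≤ CFC.log (x + y) :=
    CFC.log_le_log (add_le_add_right hry x)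
      (add_comm x _ ▸ (isStrictlyPositive_algebraMap hr).add_nonneg hx)
  have htrace := (Complex.nonneg_iff.1 (τ.map_mul_nonneg hx (sub_nonneg.2 hlog))).1
  rw [mul_sub, map_sub, Complex.sub_re, sub_nonneg] at htrace
  exact (neg_entropy_le_re_trace_mul_log_add_algebraMap τ hx hr).trans htrace

end Regularization

theorem entropy_add_entropy_le_add_mul {A B M R : Type*}
    [CStarAlgebra A] [PartialOrder A] [StarOrderedRing A]
    [CStarAlgebra B] [PartialOrder B] [StarOrderedRing B]
    [CStarAlgebra M] [PartialOrder M] [StarOrderedRing M] [FiniteDimensional ℂ M]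
    [CStarAlgebra R] [PartialOrder R] [StarOrderedRing R] [FiniteDimensional ℂ R]
    {τA : FaithfulTrace A} {τB : FaithfulTrace B} {τM : FaithfulTrace M} {τR : FaithfulTrace R}
    {ι : R →⋆ₐ[ℂ] A} (hι : Function.Injective ι) (ΦA : QuantumChannel τM τA)
    (ΦB : QuantumChannel τM τB) {ρ : M} (hρ : IsDensity τM ρ) {ε : ℝ} (hε : 0 < ε) :
    entropy τM ρ + entropy τR (embeddingAdjoint τR τA ι (ΦA ρ)) ≤
      entropy τA (ΦA ρ) + entropy τB (ΦB ρ) + Real.log (overlapConst τR ι ΦA ΦB) +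
        ε * ((τM 1).re + (τB 1).re + (τR 1).re) := by
  have := hρ.nontrivial
  have ⟨hσ, _⟩ := ΦA.isDensity_map hρ
  have ⟨hω, hω1⟩ := ΦB.isDensity_map hρ
  have hη := embeddingAdjoint_nonneg (τA := τA) (τR := τR) (ι := ι) hσ
  obtain ⟨a, ha, hEa⟩ :=
    exists_isStrictlyPositive_embeddingAdjoint_eq_one (τA := τA) (τR := τR) hι
  have hεM : IsStrictlyPositive (algebraMap ℝ M ε) := isStrictlyPositive_algebraMap hε
  have hεB : IsStrictlyPositive (algebraMap ℝ B ε) := isStrictlyPositive_algebraMap hε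
  have hεR : IsStrictlyPositive (algebraMap ℝ R ε) := isStrictlyPositive_algebraMap hε
  have hεa : IsStrictlyPositive (ε • a) := ha.smul hε
  have hE : embeddingAdjoint τR τA ι (ΦA ρ + ε • a) =
      embeddingAdjoint τR τA ι (ΦA ρ) + algebraMap ℝ R ε := by
    rw [map_add, LinearMap.map_smul_of_tower, hEa, Algebra.algebraMap_eq_smul_one]
  have htrace : (τB (ΦB ρ + algebraMap ℝ B ε)).re = 1 + ε * (τB 1).re := by
    rw [map_add, hω1, Complex.add_re, Complex.one_re, τB.re_map_algebraMap]
  have hmass : 0 ≤ ε * (τB 1).re := mul_nonneg hε.le (τB.re_map_nonneg zero_le_one)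
  have hlog : Real.log (overlapConst τR ι ΦA ΦB * (1 + ε * (τB 1).re)) ≤
      Real.log (overlapConst τR ι ΦA ΦB) + ε * (τB 1).re := by
    rw [Real.log_mul (overlapConst_pos ΦA ΦB hι).ne' (by positivity)]
    linarith [Real.log_le_sub_one_of_pos (show 0 < 1 + ε * (τB 1).re by positivity)]
  have hmain := re_trace_mul_add_re_trace_mul_le ΦA ΦB hι hρ
    (Lρ := CFC.log (ρ + algebraMap ℝ M ε)) (Lω := CFC.log (ΦB ρ + algebraMap ℝ B ε))
    (Lσ := CFC.log (ΦA ρ + ε • a))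
    (Lη := CFC.log (embeddingAdjoint τR τA ι (ΦA ρ) + algebraMap ℝ R ε))
    IsSelfAdjoint.log IsSelfAdjoint.log IsSelfAdjoint.log IsSelfAdjoint.log
    (by rw [exp_log_add hρ.1 hεM]; exact le_add_of_nonneg_right hεM.nonneg)
    (by rw [exp_log_add hσ hεa, exp_log_add hη hεR, hE])
  rw [exp_log_add hω hεB, htrace] at hmain
  linarith [neg_entropy_le_re_trace_mul_log_add τA hσ hεa,
    neg_entropy_le_re_trace_mul_log_add τB hω hεB, re_trace_mul_log_add_le τM hρ.1 hε,
    re_trace_mul_log_add_le τR hη hε]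

end ChannelSSA

end

theorem theorem3p1_general {A B M R : Type*}
    [CStarAlgebra A] [PartialOrder A] [StarOrderedRing A]
    [CStarAlgebra B] [PartialOrder B] [StarOrderedRing B]
    [CStarAlgebra M] [PartialOrder M] [StarOrderedRing M] [FiniteDimensional ℂ M]
    [CStarAlgebra R] [PartialOrder R] [StarOrderedRing R] [FiniteDimensional ℂ R]
    (τA : ChannelSSA.FaithfulTrace A) (τB : ChannelSSA.FaithfulTrace B)
    (τM : ChannelSSA.FaithfulTrace M) (τR : ChannelSSA.FaithfulTrace R)
    (ι : R →⋆ₐ[ℂ] A) (hι : Function.Injective ι)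
    (ΦA : ChannelSSA.QuantumChannel τM τA) (ΦB : ChannelSSA.QuantumChannel τM τB)
    (ρ : M) (hρ : ChannelSSA.IsDensity τM ρ) :
    IsLUB (ChannelSSA.overlapSet τR ι ΦA ΦB) (ChannelSSA.overlapConst τR ι ΦA ΦB) ∧
    0 < ChannelSSA.overlapConst τR ι ΦA ΦB ∧
    ChannelSSA.entropy τA (ΦA ρ) + ChannelSSA.entropy τB (ΦB ρ) ≥
      ChannelSSA.entropy τM ρ +
        ChannelSSA.entropy τR (ChannelSSA.embeddingAdjoint τR τA ι (ΦA ρ)) +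
        Real.log (1 / ChannelSSA.overlapConst τR ι ΦA ΦB) := by
  have := hρ.nontrivial
  refine ⟨ChannelSSA.isLUB_overlapConst ΦA ΦB hι, ChannelSSA.overlapConst_pos ΦA ΦB hι, ?_⟩
  rw [one_div, Real.log_inv, ge_iff_le, ← sub_eq_add_neg, sub_le_iff_le_add]
  refine le_of_forall_pos_le_add fun t ht => ?_
  set K := (τM 1).re + (τB 1).re + (τR 1).re
  have hK : 0 ≤ K := add_nonneg (add_nonneg (τM.re_map_nonneg zero_le_one)
    (τB.re_map_nonneg zero_le_one)) (τR.re_map_nonneg zero_le_one)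
  have herror : t / (K + 1) * K ≤ t := by
    rw [div_mul_eq_mul_div, div_le_iff₀ (by positivity)]
    exact mul_le_mul_of_nonneg_left (le_add_of_nonneg_right zero_le_one) ht.le
  have h := ChannelSSA.entropy_add_entropy_le_add_mul (τR := τR) hι ΦA ΦB hρ
    (ε := t / (K + 1)) (by positivity)
  linarith

theorem theorem3p1 {A B M R : Type*}
    [CStarAlgebra A] [PartialOrder A] [StarOrderedRing A] [FiniteDimensional ℂ A]
    [CStarAlgebra B] [PartialOrder B] [StarOrderedRing B] [FiniteDimensional ℂ B]
    [CStarAlgebra M] [PartialOrder M] [StarOrderedRing M] [FiniteDimensional ℂ M]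
    [CStarAlgebra R] [PartialOrder R] [StarOrderedRing R] [FiniteDimensional ℂ R]
    (τA : ChannelSSA.FaithfulTrace A) (τB : ChannelSSA.FaithfulTrace B)
    (τM : ChannelSSA.FaithfulTrace M) (τR : ChannelSSA.FaithfulTrace R)
    (ι : R →⋆ₐ[ℂ] A) (hι : Function.Injective ι)
    (ΦA : ChannelSSA.QuantumChannel τM τA) (ΦB : ChannelSSA.QuantumChannel τM τB)
    (ρ : M) (hρ : ChannelSSA.IsDensity τM ρ) :
    IsLUB (ChannelSSA.overlapSet τR ι ΦA ΦB) (ChannelSSA.overlapConst τR ι ΦA ΦB) ∧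
    0 < ChannelSSA.overlapConst τR ι ΦA ΦB ∧
    ChannelSSA.entropy τA (ΦA ρ) + ChannelSSA.entropy τB (ΦB ρ) ≥
      ChannelSSA.entropy τM ρ +
        ChannelSSA.entropy τR (ChannelSSA.embeddingAdjoint τR τA ι (ΦA ρ)) +
        Real.log (1 / ChannelSSA.overlapConst τR ι ΦA ΦB) :=
  theorem3p1_general τA τB τM τR ι hι ΦA ΦB ρ hρ
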